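/- All graphs are finite and simple. For a graph $G$ write $|G|$, $e(G)$, $d(G)=2e(G)/|G|$, $\delta(G)$ and $\Delta(G)$ for its number of vertices, number of edges, average degree, minimum degree and maximum degree, and for $X\subseteq V(G)$ let $e(X)$ be the number of edges of $G$ with both ends in $X$. A graph $G$ contains $T$ if $G$ has a (not necessarily induced) subgraph isomorphic to $T$. **Theorem.** Let $k$ be a positive integer and let $G$ be a graph with $d(G)>k-1$ and $\delta(G)\ge \frac k2$. (a) If $k\ge 10^{6}$ and $|G|\le (1+10^{-11})k$, then $G$ contains every tree $T$ with exactly $k$ edges and $\Delta(T)\le \frac{\sqrt k}{1000}$. (b) Let $\Delta$ be a positive integer with $k\ge 8\Delta^2$. If $V(G)$ has a partition into two sets $A$ and $B$ such that $e(A)+e(B)\le \frac{1}{50\Delta^2}\,e(G)$ and $|A|,|B|\le \left(1+\frac{1}{25\Delta^2}\right)k$, then $G$ contains every tree $T$ with exactly $k$ edges and $\Delta(T)\le\Delta$. -/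

import Mathlib

open scoped SimpleGraph

/-- The average degree `d(G)` of a finite graph. -/
noncomputable def averageDegree {V : Type*} [Fintype V] (G : SimpleGraph V)
    [DecidableRel G.Adj] : ℝ :=
  (∑ v, (G.degree v : ℝ)) / (Fintype.card V : ℝ)

/-- `e(A)`: the number of edges of `G` with both ends in `A`. -/
def edgesWithin {V : Type*} [Fintype V] [DecidableEq V] (G : SimpleGraph V)
    [DecidableRel G.Adj] (A : Finset V) : ℕ :=
  (G.edgeFinset ∩ A.sym2).card

/-- `G = (A, B)` is `β`-bipartite: `A`, `B` partition the vertex set and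
`e(A) + e(B) ≤ β e(G)`. -/
def IsBetaBipartite {V : Type*} [Fintype V] [DecidableEq V] (G : SimpleGraph V)
    [DecidableRel G.Adj] (β : ℝ) (A B : Finset V) : Prop :=
  Disjoint A B ∧ A ∪ B = Finset.univ ∧
    (edgesWithin G A : ℝ) + (edgesWithin G B : ℝ) ≤ β * (G.edgeFinset.card : ℝ)

/-- `T ∈ 𝒯(k, D)`: `T` is a tree with exactly `k` edges and maximum degree at most `D`. -/
def IsTreeOfClass {W : Type*} [Fintype W] [DecidableEq W] (T : SimpleGraph W)
    [DecidableRel T.Adj] (k : ℕ) (D : ℝ) : Prop :=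
  T.IsTree ∧ T.edgeFinset.card = k ∧ (T.maxDegree : ℝ) ≤ D

/-! The two parts have independent proofs. Both number the tree so that each vertex has at most one
earlier neighbour, and embed it in that order.

Part (b): the degree and size bounds leave few missing pairs between `A` and `B`. Each colour class
of the tree has at least `k / Δ` vertices, so each has at most `k + 1 - k / Δ`. Half of this slack
pays for deleting the vertices with more than `k / (2Δ)` non-neighbours on the other side, the other
half for the non-neighbours of a surviving vertex. The greedy embedding then never gets stuck
(`exists_copy_of_two_sides`, with the arithmetic in `missing_pairs_lt`).

Part (a): with `n = |G|`, all vertices outside a small set `S` miss at most `g`, about `n / 10 ^ 7`,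
vertices. If `n = k + 1` the copy is spanning, so the vertices of `S`, of which only degree at least
`k / 2` is known, must be used too. An independent set `L` of at least a quarter of the tree, with
degrees 1 and 2, is held back while the rest is embedded outside `S`. Hall's theorem then places `L`
(`isContained_of_partial_embedding`): each `u ∈ L` fits all but `2g` vertices of `G`, so it is
enough that every vertex `r`, in `S` or not, fits more than `2g` elements of `L`.

For this the neighbours of a small `L₀ ⊆ L` go to a reserved set `U` that contains a fair share of
every neighbourhood, and are chosen so that each `N(r)` receives its share of them. A random choice
would do; `exists_adaptive_sequence` replaces it by a choice that keeps an exponential potential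
from growing. -/

/-! ### Derandomized Chernoff bounds. -/

open Classical in
/-- One step of a derandomized Chernoff argument: if every `r` with non-zero weight finds a
proportion `q` of the candidates good, some candidate does not increase the potential. -/
theorem exists_potential_nonincreasing {V R : Type*} [Fintype R] (A : Finset V)
    (hA : A.Nonempty) (φ : R → ℝ) (hφ : ∀ r, 0 ≤ φ r) (good : R → V → Prop) (w : R → ℝ)
    (hw0 : ∀ r, 0 ≤ w r) (hw1 : ∀ r, w r ≤ 1) (q : ℝ)
    (hq : ∀ r, w r = 0 ∨ q * (A.card : ℝ) ≤ ((A.filter (good r)).card : ℝ)) :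
    ∃ x ∈ A, ∑ r, φ r * Real.exp (q / 2 * w r - if good r x then w r else 0) ≤ ∑ r, φ r := by
  -- Averaging over `A`: after exchanging the sums it suffices that, for each `r`, the factor
  -- multiplying `φ r` has mean at most 1.
  apply Finset.exists_le_of_sum_le hA
  rw [Finset.sum_comm]
  simp only [Finset.sum_const, nsmul_eq_mul]
  rw [Finset.mul_sum]
  apply Finset.sum_le_sum
  intro r _
  rw [← Finset.mul_sum, mul_comm (A.card : ℝ)]
  refine mul_le_mul_of_nonneg_left ?_ (hφ r)
  rcases hq r with h | h
  · simp [h]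
  have hw0 := hw0 r
  have hw1 := hw1 r
  have hcard : ((A.filter (good r)).card : ℝ) + ((A.filter (fun x => ¬ good r x)).card : ℝ)
      = A.card := by
    exact_mod_cast Finset.card_filter_add_card_filter_not (s := A) (good r)
  have hsum : ∑ x ∈ A, Real.exp (q / 2 * w r - if good r x then w r else 0)
      = Real.exp (q / 2 * w r) * ((A.card : ℝ) -
        (A.filter (good r)).card * (1 - Real.exp (- w r))) := by
    have : ∀ x ∈ A, Real.exp (q / 2 * w r - if good r x then w r else 0)
        = if good r x then Real.exp (q / 2 * w r) * Real.exp (- w r)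
          else Real.exp (q / 2 * w r) := by
      intro x _
      split_ifs
      · rw [← Real.exp_add]; rfl
      · simp
    rw [Finset.sum_congr rfl this, Finset.sum_ite]
    simp only [Finset.sum_const, nsmul_eq_mul]
    rw [← hcard]; ring
  rw [hsum]
  -- From `exp (-w) ≤ 1 / (1 + w) ≤ 1 - w / 2` on `[0, 1]`. The factor lost here is why only `q / 2`
  -- of the weight is guaranteed.
  have he : Real.exp (- w r) ≤ 1 - w r / 2 := by
    rw [Real.exp_neg]
    have h1 : 1 + w r ≤ Real.exp (w r) := by linarith [Real.add_one_le_exp (w r)]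
    rw [inv_le_comm₀ (Real.exp_pos _) (by linarith)]
    refine le_trans ?_ h1
    rw [inv_le_iff_one_le_mul₀ (by linarith)]
    nlinarith
  have h2 : 1 - q / 2 * w r ≤ Real.exp (- (q / 2 * w r)) := by
    linarith [Real.add_one_le_exp (- (q / 2 * w r))]
  have h3 : (A.card : ℝ) - (A.filter (good r)).card * (1 - Real.exp (- w r))
      ≤ A.card * Real.exp (- (q / 2 * w r)) := by
    have hc : (0 : ℝ) ≤ ((A.filter (good r)).card : ℝ) := by positivity
    have hc' : (0 : ℝ) ≤ (A.card : ℝ) := by positivity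
    have h4 := mul_le_mul_of_nonneg_left h2 hc'
    have h5 := mul_le_mul_of_nonneg_left (show w r / 2 ≤ 1 - Real.exp (- w r) by linarith) hc
    have h6 := mul_le_mul_of_nonneg_right h (show 0 ≤ w r / 2 by linarith)
    linarith
  calc _ ≤ Real.exp (q / 2 * w r) * (A.card * Real.exp (- (q / 2 * w r))) :=
        mul_le_mul_of_nonneg_left h3 (Real.exp_pos _).le
    _ = A.card := by
        rw [mul_left_comm, ← Real.exp_add]; simp

open Classical in
/-- A derandomized Chernoff bound for adaptively chosen sequences. The candidate sets and the
weights at step `i` may depend on the choices made before step `i`. -/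
theorem exists_adaptive_sequence {V R : Type*} [Fintype R] [Nonempty R] [Nonempty V] (N : ℕ)
    (cand : (Fin N → V) → Fin N → Finset V)
    (good : R → V → Prop) (w : R → (Fin N → V) → Fin N → ℝ) (q : ℝ)
    (hcand : ∀ x y i, (∀ j < i, x j = y j) → cand x i = cand y i)
    (hw : ∀ r x y i, (∀ j < i, x j = y j) → w r x i = w r y i)
    (hw0 : ∀ r x i, 0 ≤ w r x i) (hw1 : ∀ r x i, w r x i ≤ 1)
    (hne : ∀ x i, (∀ j < i, x j ∈ cand x j) → (cand x i).Nonempty)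
    (hq : ∀ x i, (∀ j < i, x j ∈ cand x j) → ∀ r, w r x i = 0 ∨
      q * ((cand x i).card : ℝ) ≤ (((cand x i).filter (good r)).card : ℝ)) :
    ∃ x : Fin N → V, (∀ i, x i ∈ cand x i) ∧ ∀ r,
      q / 2 * ∑ i, w r x i - Real.log (Fintype.card R)
        ≤ ∑ i, if good r (x i) then w r x i else 0 := by
  -- The potential starts at `|R|`, every exponent being an empty sum, and never grows. At the end
  -- each single term is at most `|R|`, and taking logarithms gives the claim. Coordinates from `m`
  -- on are placeholders.
  have key : ∀ m ≤ N, ∃ x : Fin N → V, (∀ i : Fin N, i.val < m → x i ∈ cand x i) ∧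
      ∑ r, Real.exp (∑ i : Fin N with i.val < m,
        (q / 2 * w r x i - if good r (x i) then w r x i else 0)) ≤ Fintype.card R := by
    intro m
    induction m with
    | zero =>
      intro _
      exact ⟨fun _ => Classical.arbitrary V, by simp, by simp⟩
    | succ m ih =>
      intro hm
      obtain ⟨x, hx, hsum⟩ := ih (by omega)
      set k : Fin N := ⟨m, hm⟩ with hk
      have hlt : ∀ j < k, x j ∈ cand x j := fun j hj => hx j hj
      obtain ⟨v, hv, hv'⟩ := exists_potential_nonincreasing (cand x k) (hne x k hlt)
        (fun r => Real.exp (∑ i : Fin N with i.val < m,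
          (q / 2 * w r x i - if good r (x i) then w r x i else 0)))
        (fun r => (Real.exp_pos _).le) good (fun r => w r x k) (fun r => hw0 r x k)
        (fun r => hw1 r x k) q (hq x k hlt)
      set y := Function.update x k v with hy
      have hyk : y k = v := by simp [hy]
      have hyx : ∀ i < k, y i = x i := fun i hi => by simp [hy, hi.ne]
      refine ⟨y, ?_, ?_⟩
      · intro i hi
        rcases (Nat.lt_succ_iff_lt_or_eq.mp hi) with h | h
        · have h' : i < k := h
          rw [hyx i h', hcand y x i fun j hj => hyx j (hj.trans h')]
          exact hx i h
        · have h' : i = k := Fin.ext h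
          subst h'
          rw [hyk, hcand y x _ hyx]
          exact hv
      · refine le_trans (le_of_eq ?_) (hv'.trans hsum)
        refine Finset.sum_congr rfl fun r _ => ?_
        have hset : (Finset.univ.filter fun i : Fin N => i.val < m + 1)
            = insert k (Finset.univ.filter fun i : Fin N => i.val < m) := by
          ext i
          simp [hk, Fin.ext_iff]
          omega
        rw [hset, Finset.sum_insert (by simp [hk]), ← Real.exp_add, add_comm]
        congr 2
        · refine Finset.sum_congr rfl fun i hi => ?_
          have h' : i < k := (Finset.mem_filter.mp hi).2
          rw [hyx i h', hw r y x i fun j hj => hyx j (hj.trans h')]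
        · rw [hyk, hw r y x k hyx]
  obtain ⟨x, hx, hsum⟩ := key N le_rfl
  refine ⟨x, fun i => hx i i.2, fun r => ?_⟩
  have h1 := (Finset.single_le_sum (f := fun r => Real.exp (∑ i : Fin N with i.val < N,
        (q / 2 * w r x i - if good r (x i) then w r x i else 0)))
        (fun r _ => (Real.exp_pos _).le) (Finset.mem_univ r)).trans hsum
  have h2 := (Real.le_log_iff_exp_le (by exact_mod_cast Fintype.card_pos)).2 h1
  have h3 : (Finset.univ.filter fun i : Fin N => i.val < N) = Finset.univ := by
    ext i; simp
  rw [h3, Finset.sum_sub_distrib, ← Finset.mul_sum] at h2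
  linarith

/-! ### Numberings and degree counts in trees. -/

namespace SimpleGraph

/-- The vertices of a finite tree can be numbered such that every vertex has at most one
neighbour with a smaller number. -/
theorem IsTree.exists_numbering (N : ℕ) : ∀ {W : Type*} [Fintype W] (T : SimpleGraph W),
    T.IsTree → Fintype.card W = N → ∃ e : W → ℕ, Function.Injective e ∧ (∀ v, e v < N) ∧
      ∀ v a b, T.Adj v a → T.Adj v b → e a < e v → e b < e v → a = b := by
  induction N with
  | zero =>
    intro W _ T hT hcard
    have := hT.1.nonempty
    exact absurd hcard Fintype.card_ne_zero
  | succ N ih =>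
    intro W _ T hT hcard
    classical
    rcases subsingleton_or_nontrivial W with hs | hn
    · exact ⟨fun _ => 0, fun a b _ => Subsingleton.elim a b, fun _ => by simp,
        fun _ a b _ _ _ _ => Subsingleton.elim a b⟩
    -- A leaf gets the last number: it then has one earlier neighbour, and is an earlier neighbour
    -- of nothing.
    obtain ⟨v, hv⟩ := hT.exists_vert_degree_one_of_nontrivial
    have hT' : (T.induce ({v}ᶜ : Set W)).IsTree :=
      ⟨hT.1.induce_compl_singleton_of_degree_eq_one hv, hT.2.induce _⟩
    obtain ⟨e, he, heN, hadj⟩ := ih (T.induce ({v}ᶜ : Set W)) hT' (by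
      rw [Fintype.card_compl_set]; simp [hcard])
    have hE : ∀ a (h : a ≠ v), (if h : a = v then N else e ⟨a, h⟩) = e ⟨a, h⟩ :=
      fun a h => dif_neg h
    refine ⟨fun a => if h : a = v then N else e ⟨a, h⟩, ?_, ?_, ?_⟩
    · intro a b hab
      by_cases ha : a = v <;> by_cases hb : b = v
      · rw [ha, hb]
      · have := heN ⟨b, hb⟩
        simp [ha, hb] at hab; omega
      · have := heN ⟨a, ha⟩
        simp [ha, hb] at hab; omega
      · simp only [ha, hb, dite_false] at hab
        exact congrArg Subtype.val (he hab)
    · intro a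
      by_cases ha : a = v
      · simp [ha]
      · have := heN ⟨a, ha⟩
        simp [ha]; omega
    · intro u a b hua hub hau hbu
      by_cases hu : u = v
      · subst hu
        rw [← card_neighborFinset_eq_degree, Finset.card_eq_one] at hv
        obtain ⟨z, hz⟩ := hv
        have h1 : a ∈ T.neighborFinset u := by simpa using hua
        have h2 : b ∈ T.neighborFinset u := by simpa using hub
        rw [hz, Finset.mem_singleton] at h1 h2
        rw [h1, h2]
      · have hNu := heN ⟨u, hu⟩
        have ha : a ≠ v := by
          rintro rfl; simp [hu] at hau; omega
        have hb : b ≠ v := by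
          rintro rfl; simp [hu] at hbu; omega
        simp only [hu, ha, hb, dite_false] at hau hbu
        have := hadj ⟨u, hu⟩ ⟨a, ha⟩ ⟨b, hb⟩ hua hub hau hbu
        exact congrArg Subtype.val this

/-- A tree is isomorphic to a tree on `Fin N` in which every vertex has at most one smaller
neighbour. -/
theorem IsTree.exists_iso_fin {W : Type*} [Fintype W] {T : SimpleGraph W} (hT : T.IsTree)
    {N : ℕ} (hN : Fintype.card W = N) :
    ∃ T' : SimpleGraph (Fin N), Nonempty (T ≃g T') ∧
      ∀ i a b, T'.Adj i a → T'.Adj i b → a < i → b < i → a = b := by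
  obtain ⟨e, he, heN, hadj⟩ := IsTree.exists_numbering N T hT hN
  have hbij : Function.Bijective (fun v => (⟨e v, heN v⟩ : Fin N)) := by
    rw [Fintype.bijective_iff_injective_and_card]
    exact ⟨fun a b hab => he (by simpa using hab), by simp [hN]⟩
  let E : W ≃ Fin N := Equiv.ofBijective _ hbij
  refine ⟨T.map E.toEmbedding, ⟨Iso.map E T⟩, ?_⟩
  have hE : ∀ i : Fin N, (i : ℕ) = e (E.symm i) := fun i =>
    congrArg Fin.val (E.apply_symm_apply i).symm
  have hmap : ∀ i a, (T.map E.toEmbedding).Adj i a → T.Adj (E.symm i) (E.symm a) := by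
    rintro i a h
    simp only [map_adj] at h
    obtain ⟨u, v, huv, rfl, rfl⟩ := h
    simpa using huv
  intro i a b ha hb hai hbi
  rw [Fin.lt_def, hE, hE] at hai hbi
  exact E.symm.injective (hadj _ _ _ (hmap i a ha) (hmap i b hb) hai hbi)

/-- In a tree with maximum degree at most `D`, each class of a proper 2-colouring has at least
a `1 / D` proportion of the edges. -/
theorem card_edgeFinset_le_mul_card_colorClass {W : Type*} [Fintype W] [DecidableEq W]
    {T : SimpleGraph W} [DecidableRel T.Adj] (c : T.Coloring Bool) (b : Bool) {D : ℕ}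
    (hD : ∀ v, T.degree v ≤ D) :
    T.edgeFinset.card ≤ D * (Finset.univ.filter fun v => c v = b).card := by
  have hb : T.IsBipartiteWith (Finset.univ.filter fun v => c v = b : Finset W)
      (Finset.univ.filter fun v => c v = !b : Finset W) := by
    constructor
    · rw [Finset.disjoint_coe, Finset.disjoint_filter]
      intro v _ h; simp [h]
    · intro v w hvw
      have := c.valid hvw
      simp only [Finset.coe_filter, Finset.mem_univ, true_and, Set.mem_ofPred_eq]
      revert this
      cases c v <;> cases c w <;> cases b <;> simp
  rw [← isBipartiteWith_sum_degrees_eq_card_edges hb, mul_comm]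
  exact Finset.sum_le_card_nsmul _ _ _ fun v _ => hD v

/-- At least half of the vertices of a tree with at least one edge have degree 1 or 2. -/
theorem IsTree.card_le_two_mul_card_degree_le_two {W : Type*} [Fintype W] [Nontrivial W]
    {T : SimpleGraph W} [DecidableRel T.Adj] (hT : T.IsTree) :
    Fintype.card W ≤ 2 * (Finset.univ.filter fun v => T.degree v ≤ 2).card := by
  have h1 := T.sum_degrees_eq_twice_card_edges
  have h2 := hT.card_edgeFinset
  have hpos : ∀ v, 1 ≤ T.degree v := fun v => hT.1.preconnected.degree_pos_of_nontrivial v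
  -- All degrees are positive, so a bonus of 2 lifts each low degree to at least 3, whereas the
  -- degrees alone sum to less than `2 |W|`.
  have h3 : ∑ v : W, 3 ≤ ∑ v, (T.degree v + if T.degree v ≤ 2 then 2 else 0) := by
    apply Finset.sum_le_sum
    intro v _
    have := hpos v
    split_ifs <;> omega
  rw [Finset.sum_add_distrib, h1, ← Finset.sum_filter] at h3
  simp at h3
  omega

end SimpleGraph

/-! ### Part (b): greedy embedding into a nearly complete bipartite graph. -/

namespace SimpleGraph

open Classical in
/-- Greedy embedding of a 2-coloured tree into an almost complete bipartite graph. -/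
theorem exists_copy_of_two_sides {V : Type*} [Nonempty V] (G : SimpleGraph V) {N : ℕ}
    (T : SimpleGraph (Fin N))
    (hT : ∀ i a b, T.Adj i a → T.Adj i b → a < i → b < i → a = b)
    (c : T.Coloring Bool) (side : Bool → Finset V)
    (hside : Disjoint (side true) (side false))
    (hcard : ∀ b, (Finset.univ.filter fun i => c i = b).card ≤ (side b).card)
    (hdeg : ∀ b, ∀ v ∈ side (!b), ((side b).filter fun x => ¬ G.Adj v x).card +
      (Finset.univ.filter fun i => c i = b).card ≤ (side b).card) : T ⊑ G := by
  have hsep : ∀ b b' v, v ∈ side b → v ∈ side b' → b = b' := by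
    have := Finset.disjoint_left.mp hside
    intro b b' v h h'
    cases b <;> cases b' <;> first | rfl | exact absurd h (this h') | exact absurd h' (this h)
  set cand : (Fin N → V) → Fin N → Finset V := fun x i => (side (c i)).filter fun v =>
    (∀ j < i, x j ≠ v) ∧ ∀ j < i, T.Adj i j → G.Adj (x j) v with hcanddef
  -- With zero weights this is plain greedy selection; only nonemptiness of the candidate sets
  -- matters.
  obtain ⟨x, hx, -⟩ := exists_adaptive_sequence (R := Unit) N cand
    (fun _ _ => True) (fun _ _ _ => 0) 0
    (by
      intro x y i h
      refine Finset.filter_congr fun v _ => ?_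
      refine and_congr ?_ ?_ <;>
      refine forall_congr' fun j => forall_congr' fun hj => by rw [h j hj])
    (by simp) (by simp) (by simp) (by
      intro x i hx
      set used := (Finset.univ.filter fun j => j < i ∧ c j = c i).image x
      -- Strict because `i` itself is not yet placed; this leaves the one free vertex needed.
      have hused : used.card < (Finset.univ.filter fun j => c j = c i).card := by
        refine Finset.card_image_le.trans_lt (Finset.card_lt_card ?_)
        rw [Finset.ssubset_iff_of_subset (fun j hj => by
          simp only [Finset.mem_filter] at hj ⊢; exact ⟨hj.1, hj.2.2⟩)]
        exact ⟨i, by simp, by simp⟩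
      obtain ⟨bad, hbad, hbad'⟩ : ∃ bad : Finset V,
          bad.card + (Finset.univ.filter fun j => c j = c i).card ≤ (side (c i)).card ∧
          ∀ v ∈ side (c i), v ∉ bad → ∀ j < i, T.Adj i j → G.Adj (x j) v := by
        by_cases h : ∃ j, j < i ∧ T.Adj i j
        · obtain ⟨j, hj, hij⟩ := h
          refine ⟨(side (c i)).filter fun v => ¬ G.Adj (x j) v, hdeg _ _ ?_, ?_⟩
          · have h1 := (Finset.mem_filter.mp (hx j hj)).1
            have h2 := c.valid hij
            have h3 : c j = !c i := by
              revert h2; cases c i <;> cases c j <;> simp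
            rwa [h3] at h1
          · intro v hv hvb l hl hil
            rw [hT i l j hil hij hl hj]
            simpa [hv] using hvb
        · exact ⟨∅, by simpa using hcard (c i), fun v _ _ j hj hij => absurd ⟨j, hj, hij⟩ h⟩
      obtain ⟨v, hv, hv'⟩ : ∃ v ∈ side (c i), v ∉ bad ∪ used := by
        apply Finset.exists_mem_notMem_of_card_lt_card
        have := Finset.card_union_le bad used
        omega
      rw [Finset.mem_union, not_or] at hv'
      refine ⟨v, Finset.mem_filter.mpr ⟨hv, ?_, hbad' v hv hv'.1⟩⟩
      rintro j hj rfl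
      refine hv'.2 (Finset.mem_image_of_mem _ ?_)
      simp only [Finset.mem_filter, Finset.mem_univ, true_and]
      exact ⟨hj, hsep _ _ _ (Finset.mem_filter.mp (hx j hj)).1 hv⟩)
    (by simp)
  have hx' := fun i => (Finset.mem_filter.mp (hx i)).2
  refine ⟨⟨⟨x, ?_⟩, ?_⟩⟩
  · intro i j hij
    rcases lt_trichotomy i j with h | h | h
    · exact (hx' j).2 i h hij.symm
    · exact absurd h hij.ne
    · exact ((hx' i).2 j h hij).symm
  · intro i j hij
    by_contra hne
    rcases lt_or_gt_of_ne hne with h | h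
    · exact (hx' j).1 i h hij
    · exact (hx' i).1 j h hij.symm

open Classical in
/-- Markov's inequality for the non-neighbours across a pair of vertex sets. -/
theorem card_filter_nonadj_mul_le {V : Type*} (G : SimpleGraph V) [DecidableRel G.Adj]
    (A B : Finset V) (θ : ℝ) :
    θ * ((A.filter fun a => θ < ((B.filter fun b => ¬ G.Adj a b).card : ℝ)).card : ℝ)
      ≤ A.card * B.card - (G.interedges A B).card := by
  have h1 : ∀ a ∈ A, ((B.filter fun b => G.Adj a b).card : ℝ)
      + ((B.filter fun b => ¬ G.Adj a b).card : ℝ) = B.card := fun a _ => by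
    exact_mod_cast Finset.card_filter_add_card_filter_not (s := B) (G.Adj a)
  have h2 : ((G.interedges A B).card : ℝ) = ∑ a ∈ A, ((B.filter fun b => G.Adj a b).card : ℝ) := by
    rw [interedges_def, Finset.card_filter, Finset.sum_product]
    push_cast
    refine Finset.sum_congr rfl fun a _ => ?_
    rw [Finset.card_filter]; push_cast; rfl
  have h3 : (A.card * B.card : ℝ) - (G.interedges A B).card
      = ∑ a ∈ A, ((B.filter fun b => ¬ G.Adj a b).card : ℝ) := by
    have := Finset.sum_congr rfl h1
    rw [Finset.sum_add_distrib, Finset.sum_const, nsmul_eq_mul] at this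
    linarith
  rw [h3, mul_comm, ← nsmul_eq_mul, ← Finset.sum_const]
  refine (Finset.sum_le_sum fun a ha => (Finset.mem_filter.mp ha).2.le).trans ?_
  exact Finset.sum_le_sum_of_subset_of_nonneg (Finset.filter_subset _ _) fun _ _ _ => by positivity

/-- Every edge lies in `A`, in `B`, or goes across. -/
theorem card_edgeFinset_le_of_union_eq_univ {V : Type*} [Fintype V] [DecidableEq V]
    (G : SimpleGraph V) [DecidableRel G.Adj] {A B : Finset V} (h : A ∪ B = Finset.univ) :
    G.edgeFinset.card ≤ edgesWithin G A + edgesWithin G B + (G.interedges A B).card := by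
  have hsub : G.edgeFinset ⊆ (G.edgeFinset ∩ A.sym2) ∪ (G.edgeFinset ∩ B.sym2) ∪
      (G.interedges A B).image fun p => s(p.1, p.2) := by
    intro e
    induction e with
    | h u v =>
      intro he
      have hu : u ∈ A ∪ B := h ▸ Finset.mem_univ u
      have hv : v ∈ A ∪ B := h ▸ Finset.mem_univ v
      have huv : G.Adj u v := by simpa using he
      simp only [Finset.mem_union, Finset.mem_inter, Finset.mk_mem_sym2_iff, Finset.mem_image,
        mem_interedges_iff, Prod.exists] at hu hv ⊢
      rcases hu with hu | hu <;> rcases hv with hv | hv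
      · exact Or.inl (Or.inl ⟨he, hu, hv⟩)
      · exact Or.inr ⟨u, v, ⟨hu, hv, huv⟩, rfl⟩
      · exact Or.inr ⟨v, u, ⟨hv, hu, huv.symm⟩, Sym2.eq_swap⟩
      · exact Or.inl (Or.inr ⟨he, hu, hv⟩)
  refine (Finset.card_le_card hsub).trans ((Finset.card_union_le _ _).trans ?_)
  exact add_le_add (Finset.card_union_le _ _) Finset.card_image_le

end SimpleGraph

/-- The sum of the degrees is `d(G) |G|`. -/
theorem averageDegree_mul_card {V : Type*} [Fintype V] [Nonempty V] (G : SimpleGraph V)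
    [DecidableRel G.Adj] :
    averageDegree G * Fintype.card V = ∑ v, (G.degree v : ℝ) := by
  unfold averageDegree
  exact div_mul_cancel₀ _ (by exact_mod_cast Fintype.card_ne_zero)

/-- The numerical inequality behind the greedy embedding into a nearly complete bipartite graph
with sides of sizes `a` and `b` and `E` edges. -/
theorem missing_pairs_lt {k D a b E : ℝ} (hD : 2 ≤ D) (hk : 8 * D ^ 2 ≤ k)
    (ha0 : 0 ≤ a) (hb0 : 0 ≤ b)
    (ha : a ≤ (1 + 1 / (25 * D ^ 2)) * k) (hb : b ≤ (1 + 1 / (25 * D ^ 2)) * k)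
    (hE : (1 - 1 / (50 * D ^ 2)) * ((k - 1) * (a + b) / 2) < E) (hE' : E ≤ a * b) :
    a * b - E < k / (2 * D) * (b - k + k / (2 * D)) := by
  have hD0 : 0 < D := by linarith
  set u := 1 / D with hu
  have hu0 : 0 < u := by positivity
  have hu2 : u ≤ 1 / 2 := by rw [hu]; exact one_div_le_one_div_of_le (by norm_num) hD
  have hDu : D * u = 1 := by rw [hu]; field_simp
  have e1 : 1 / (25 * D ^ 2) = u ^ 2 / 25 := by rw [hu]; field_simp
  have e2 : 1 / (50 * D ^ 2) = u ^ 2 / 50 := by rw [hu]; field_simp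
  have e3 : k / (2 * D) = k * u / 2 := by rw [hu]; field_simp
  rw [e1] at ha hb
  rw [e2] at hE
  rw [e3]
  have hk1 : 8 ≤ k * u ^ 2 := by
    have := mul_le_mul_of_nonneg_right hk (sq_nonneg u)
    have h2 : 8 * D ^ 2 * u ^ 2 = 8 := by
      rw [mul_assoc, ← mul_pow, hDu]; norm_num
    linarith
  have hu4 : u ^ 2 ≤ 1 / 4 := by nlinarith
  have hk0 : 32 ≤ k := by nlinarith
  set K := (1 + u ^ 2 / 25) * k with hK
  set e0 := (1 - u ^ 2 / 50) * (k - 1) with he0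
  have hE2 : e0 * (a + b) / 2 < E := by rw [he0]; linarith
  have he0pos : 0 < e0 := mul_pos (by linarith) (by linarith)
  have he0k : e0 ≤ k := by rw [he0]; nlinarith
  -- Otherwise `E ≤ a * b ≤ e0 * a / 2`, below the lower bound for `E`.
  have hbe : e0 / 2 ≤ b := by
    by_contra hcon
    push Not at hcon
    have h1 : a * (b - e0 / 2) ≤ 0 := mul_nonpos_of_nonneg_of_nonpos ha0 (by linarith)
    have h2 : 0 ≤ e0 * b := by positivity
    linarith
  have hu2k : 0 ≤ k * u ^ 2 := by positivity
  have hkK : K = k + k * u ^ 2 / 25 := by rw [hK]; ring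
  have hkuk : k * u ≤ k / 2 := by
    have := mul_le_mul_of_nonneg_left hu2 (show 0 ≤ k by linarith)
    linarith
  -- After `E` is replaced by its lower bound, the difference of the two sides is nondecreasing in
  -- `a`, and then in `b`, so the worst case is `a = b = K`.
  have h1 : a * (b - e0 / 2) ≤ K * (b - e0 / 2) := mul_le_mul_of_nonneg_right ha (by linarith)
  have h2 : b * (K - e0 / 2 - k * u / 2) ≤ K * (K - e0 / 2 - k * u / 2) :=
    mul_le_mul_of_nonneg_right hb (by linarith)
  suffices h3 : K * (K - e0) < k * u / 2 * (K - k + k * u / 2) by linarith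
  have h4 : K - e0 = k * u ^ 2 * (3 / 50) + 1 - u ^ 2 / 50 := by rw [hK, he0]; ring
  -- `37 / 200 = 3 / 50 + 1 / 8`, where `1 ≤ k * u ^ 2 / 8` is the bound `8 * D ^ 2 ≤ k`. The
  -- comparison closes since `101 / 100 * 37 / 200 < 1 / 4`.
  have h5 : K - e0 ≤ k * u ^ 2 * (37 / 200) := by
    rw [h4]; linarith [sq_nonneg u]
  have h6 : K ≤ k * (101 / 100) := by
    have := mul_le_mul_of_nonneg_left hu4 (show 0 ≤ k by linarith)
    rw [hkK]; linarith
  have h7 : K * (K - e0) ≤ k * (101 / 100) * (k * u ^ 2 * (37 / 200)) :=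
    mul_le_mul h6 h5 (by linarith) (by linarith)
  have h8 : 0 < k * k * u ^ 2 := by positivity
  have h9 : 0 ≤ k * u / 2 * (K - k) := mul_nonneg (by positivity) (by linarith)
  linarith

open Classical in
/-- Bounded degree trees in graphs that are nearly complete and balanced bipartite. -/
theorem isContained_of_isBetaBipartite {V : Type*} [Fintype V] [DecidableEq V]
    (G : SimpleGraph V) [DecidableRel G.Adj] (k : ℕ) (hd : (k : ℝ) - 1 < averageDegree G)
    (D : ℕ) (hD1 : 1 ≤ D) (hk : 8 * D ^ 2 ≤ k) (A B : Finset V)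
    (hAB : IsBetaBipartite G (1 / (50 * (D : ℝ) ^ 2)) A B)
    (hA : (A.card : ℝ) ≤ (1 + 1 / (25 * (D : ℝ) ^ 2)) * (k : ℝ))
    (hB : (B.card : ℝ) ≤ (1 + 1 / (25 * (D : ℝ) ^ 2)) * (k : ℝ))
    {W : Type*} [Fintype W] [DecidableEq W] (T : SimpleGraph W) [DecidableRel T.Adj]
    (hT : IsTreeOfClass T k (D : ℝ)) : T ⊑ G := by
  obtain ⟨hdis, hun, hβ⟩ := hAB
  obtain ⟨htree, hedges, hmax⟩ := hT
  have hcW : Fintype.card W = k + 1 := by rw [← hedges, htree.card_edgeFinset]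
  have hDdeg : ∀ v, T.degree v ≤ D := fun v =>
    (T.degree_le_maxDegree v).trans (by exact_mod_cast hmax)
  have hk8 : 8 ≤ k := le_trans (by nlinarith) hk
  obtain ⟨c2⟩ := htree.colorable_two
  have c : T.Coloring Bool := (SimpleGraph.Iso.completeGraph finTwoEquiv).toHom.comp c2
  have hcls := fun b => T.card_edgeFinset_le_mul_card_colorClass c b hDdeg
  have hclsum : (Finset.univ.filter fun v => c v = true).card +
      (Finset.univ.filter fun v => c v = false).card = k + 1 := by
    rw [← hcW, ← Finset.card_univ,
      ← Finset.card_filter_add_card_filter_not (s := Finset.univ) (fun v => c v = true)]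
    simp
  rw [hedges] at hcls
  -- For `D = 1` both colour classes would have at least `k` of the `k + 1` vertices.
  have hD2 : 2 ≤ D := by
    by_contra hcon
    have : D = 1 := by omega
    subst this
    have h1 := hcls true
    have h2 := hcls false
    omega
  have hD2' : (2 : ℝ) ≤ D := by exact_mod_cast hD2
  have hk' : 8 * (D : ℝ) ^ 2 ≤ k := by exact_mod_cast hk
  have hV : Nonempty V := by
    by_contra hcon
    rw [not_nonempty_iff] at hcon
    simp only [averageDegree, Finset.univ_eq_empty, Finset.sum_empty, zero_div] at hd
    have : (8 : ℝ) ≤ k := by exact_mod_cast hk8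
    linarith
  have hcardV : (Fintype.card V : ℝ) = A.card + B.card := by
    rw [← Finset.card_univ, ← hun, Finset.card_union_of_disjoint hdis]; push_cast; ring
  have hVpos : (0 : ℝ) < Fintype.card V := by exact_mod_cast Fintype.card_pos
  have heG : ((k : ℝ) - 1) * (A.card + B.card) / 2 < (G.edgeFinset.card : ℝ) := by
    have h1 := averageDegree_mul_card G
    have h2 : ∑ v, (G.degree v : ℝ) = 2 * G.edgeFinset.card := by
      exact_mod_cast G.sum_degrees_eq_twice_card_edges
    have h3 := mul_lt_mul_of_pos_right hd hVpos
    rw [hcardV] at h3 h1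
    linarith
  have hβ1 : 1 / (50 * (D : ℝ) ^ 2) < 1 := by
    rw [div_lt_one (by positivity)]; nlinarith
  have hE : (1 - 1 / (50 * (D : ℝ) ^ 2)) * (((k : ℝ) - 1) * (A.card + B.card) / 2)
      < (G.interedges A B).card := by
    have h1 : (G.edgeFinset.card : ℝ) ≤ edgesWithin G A + edgesWithin G B
        + (G.interedges A B).card := by
      exact_mod_cast G.card_edgeFinset_le_of_union_eq_univ hun
    have h2 := mul_lt_mul_of_pos_left heG (sub_pos.mpr hβ1)
    linarith
  have hE' : ((G.interedges A B).card : ℝ) ≤ A.card * B.card := by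
    exact_mod_cast G.card_interedges_le_mul A B
  have hsymm : (G.interedges A B).card = (G.interedges B A).card :=
    have := G.symm
    Rel.card_interedges_comm A B
  -- Each class has at most `k + 1 - 2 * θ` vertices. One `θ` is spent on deleted vertices, the
  -- other on non-neighbours.
  set θ : ℝ := k / (2 * D) with hθ
  have hθ0 : 0 < θ := by
    have : (0 : ℝ) < k := by exact_mod_cast (by omega : 0 < k)
    positivity
  have hclass : ∀ b, ((Finset.univ.filter fun v => c v = b).card : ℝ) - 1 ≤ k - 2 * θ := by
    intro b
    have h1 : (k : ℝ) ≤ D * (Finset.univ.filter fun v => c v = !b).card := by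
      exact_mod_cast hcls (!b)
    have h2 : ((Finset.univ.filter fun v => c v = b).card : ℝ) +
        (Finset.univ.filter fun v => c v = !b).card = k + 1 := by
      cases b
      · rw [add_comm]; exact_mod_cast hclsum
      · exact_mod_cast hclsum
    have h3 : 2 * θ ≤ (Finset.univ.filter fun v => c v = !b).card := by
      have : 2 * θ = k / D := by rw [hθ]; field_simp
      rw [this, div_le_iff₀ (by linarith)]
      linarith
    linarith
  have hmain : ∀ X Y : Finset V, ((X.card : ℝ) * Y.card - (G.interedges Y X).card
      < θ * (Y.card - k + θ)) → ∀ b, (Finset.univ.filter fun v => c v = b).card + θ - 1 <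
      ((Y.filter fun y => ((X.filter fun x => ¬ G.Adj y x).card : ℝ) ≤ θ).card : ℝ) := by
    intro X Y h b
    have h1 := G.card_filter_nonadj_mul_le Y X θ
    have h2 : ((Y.filter fun y => ((X.filter fun x => ¬ G.Adj y x).card : ℝ) ≤ θ).card : ℝ) +
        ((Y.filter fun y => θ < ((X.filter fun x => ¬ G.Adj y x).card : ℝ)).card : ℝ)
        = Y.card := by
      have := Finset.card_filter_add_card_filter_not (s := Y)
        (fun y => ((X.filter fun x => ¬ G.Adj y x).card : ℝ) ≤ θ)
      simp only [not_le] at this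
      exact_mod_cast this
    have h3 : ((Y.filter fun y => θ < ((X.filter fun x => ¬ G.Adj y x).card : ℝ)).card : ℝ)
        < Y.card - k + θ := by
      refine lt_of_mul_lt_mul_left ?_ hθ0.le
      linarith [mul_comm (X.card : ℝ) Y.card]
    have := hclass b
    linarith
  have hmB := hmain A B (by
    rw [← hsymm]
    exact missing_pairs_lt hD2' hk' (by positivity) (by positivity) hA hB hE hE')
  have hmA := hmain B A (by
    rw [mul_comm] at hE'
    rw [add_comm (A.card : ℝ)] at hE
    exact missing_pairs_lt hD2' hk' (by positivity) (by positivity) hB hA hE hE')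
  set A' := A.filter fun y => ((B.filter fun x => ¬ G.Adj y x).card : ℝ) ≤ θ
  set B' := B.filter fun y => ((A.filter fun x => ¬ G.Adj y x).card : ℝ) ≤ θ
  obtain ⟨T', ⟨φ⟩, hT'⟩ := htree.exists_iso_fin hcW
  let c' : T'.Coloring Bool := c.comp φ.symm.toHom
  have hcc : ∀ b, (Finset.univ.filter fun i => c' i = b).card
      = (Finset.univ.filter fun v => c v = b).card := by
    intro b
    refine Finset.card_bij (fun i _ => φ.symm i) ?_ ?_ ?_
    · intro i hi; simpa [c'] using hi
    · intro i _ j _ h; exact φ.symm.injective h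
    · intro v hv; exact ⟨φ v, by simpa [c'] using hv, by simp⟩
  -- Integrality absorbs the `- 1` that comes from the tree having `k + 1` vertices.
  have hnat : ∀ m n s : ℕ, (m : ℝ) ≤ θ → (n : ℝ) + θ - 1 < s → m + n ≤ s := by
    intro m n s h1 h2
    have : ((m + n : ℕ) : ℝ) < ((s + 1 : ℕ) : ℝ) := by push_cast; linarith
    have := Nat.cast_lt.mp this
    omega
  have hcontained : T' ⊑ G := by
    refine SimpleGraph.exists_copy_of_two_sides G T' hT' c' (fun b => if b then A' else B') ?_ ?_ ?_
    · simp only [if_true, Bool.false_eq_true, if_false]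
      exact Finset.disjoint_of_subset_left (Finset.filter_subset _ _)
        (Finset.disjoint_of_subset_right (Finset.filter_subset _ _) hdis)
    · intro b
      rw [hcc]
      have := hnat 0 _ _ (by simpa using hθ0.le) (hmA b)
      have := hnat 0 _ _ (by simpa using hθ0.le) (hmB b)
      cases b <;> simp <;> omega
    · intro b v hv
      rw [hcc]
      cases b
      · simp only [Bool.not_false, if_true] at hv
        refine hnat _ _ _ (le_trans ?_ (Finset.mem_filter.mp hv).2) (hmB _)
        refine Nat.cast_le.mpr (Finset.card_le_card fun x hx => ?_)
        simp only [Finset.mem_filter, Bool.false_eq_true, if_false, B'] at hx ⊢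
        exact ⟨hx.1.1, hx.2⟩
      · simp only [Bool.not_true] at hv
        refine hnat _ _ _ (le_trans ?_ (Finset.mem_filter.mp hv).2) (hmA _)
        refine Nat.cast_le.mpr (Finset.card_le_card fun x hx => ?_)
        simp only [Finset.mem_filter, if_true, A'] at hx ⊢
        exact ⟨hx.1.1, hx.2⟩
  exact φ.isContained.trans hcontained

/-! ### Part (a): reserved set, partial embedding and completion by Hall's theorem. -/

namespace SimpleGraph

open Classical in
/-- If all degrees are large, there is a set of `s` vertices that contains a fair share of every
neighbourhood. -/
theorem exists_balanced_subset {V : Type*} [Fintype V] [Nonempty V] (G : SimpleGraph V) (s : ℕ) (q : ℝ) (hs : s ≤ Fintype.card V) (hq0 : 0 ≤ q)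
    (hq : ∀ r, q * Fintype.card V + s ≤ G.degree r) :
    ∃ U : Finset V, U.card = s ∧
      ∀ r, q / 2 * s - Real.log (Fintype.card V) ≤ ((U.filter fun y => G.Adj y r).card : ℝ) := by
  have hused : ∀ (x : Fin s → V) (i : Fin s),
      ((Finset.univ.filter (· < i)).image x).card < s := fun x i =>
    Finset.card_image_le.trans_lt ((Finset.card_lt_card (by
      rw [Finset.ssubset_univ_iff, Ne, Finset.filter_eq_self]
      exact fun h => lt_irrefl i (by simpa using h i))).trans_eq (by simp))
  -- Pick unused vertices one by one: fewer than `s` are used up, so `N(r)` always keeps a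
  -- proportion `q` of the candidates.
  obtain ⟨x, hx, hsum⟩ := exists_adaptive_sequence (R := V) s
    (fun x i => Finset.univ \ (Finset.univ.filter (· < i)).image x)
    (fun r v => G.Adj v r) (fun _ _ _ => 1) q
    (by
      intro x y i h
      congr 1
      exact Finset.image_congr fun j hj => h j (by simpa using hj))
    (by simp) (by simp) (by simp)
    (by
      intro x i _
      have h1 := hused x i
      have h2 := Finset.le_card_sdiff ((Finset.univ.filter (· < i)).image x) Finset.univ
      rw [Finset.card_univ] at h2
      exact Finset.card_pos.mp (by omega))
    (by
      intro x i _ r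
      right
      have h1 : G.neighborFinset r \ (Finset.univ.filter (· < i)).image x ⊆
          (Finset.univ \ (Finset.univ.filter (· < i)).image x).filter fun v => G.Adj v r := by
        intro v hv
        simp only [Finset.mem_sdiff, mem_neighborFinset] at hv
        simp only [Finset.mem_filter, Finset.mem_sdiff, Finset.mem_univ, true_and]
        exact ⟨hv.2, hv.1.symm⟩
      have h2 := (Finset.le_card_sdiff _ _).trans (Finset.card_le_card h1)
      rw [card_neighborFinset_eq_degree] at h2
      have h3 : G.degree r ≤ ((Finset.univ \ (Finset.univ.filter (· < i)).image x).filter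
          fun v => G.Adj v r).card + s := by
        have := hused x i
        omega
      have h4 : (G.degree r : ℝ) ≤ ((Finset.univ \ (Finset.univ.filter (· < i)).image x).filter
          fun v => G.Adj v r).card + s := by exact_mod_cast h3
      have h5 : ((Finset.univ \ (Finset.univ.filter (· < i)).image x).card : ℝ)
          ≤ Fintype.card V := by exact_mod_cast Finset.card_le_univ _
      have h6 := mul_le_mul_of_nonneg_left h5 hq0
      linarith [hq r])
  have hne : ∀ i j, i < j → x i ≠ x j := fun i j hij h =>
    (Finset.mem_sdiff.mp (hx j)).2 (h ▸ Finset.mem_image_of_mem x (by simpa using hij))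
  have hinj : Function.Injective x := by
    intro i j hij
    by_contra h
    rcases lt_or_gt_of_ne h with h | h
    · exact hne i j h hij
    · exact hne j i h hij.symm
  refine ⟨Finset.univ.image x, by rw [Finset.card_image_of_injective _ hinj]; simp, fun r => ?_⟩
  have := hsum r
  rw [← Finset.sum_filter] at this
  simp only [Finset.sum_const, nsmul_eq_mul, mul_one, Finset.card_univ, Fintype.card_fin] at this
  rwa [Finset.filter_image, Finset.card_image_of_injective _ hinj]

open Classical in
/-- Double counting for vertices of degree 1 or 2 in an ordered graph. Given a set `p` of good
vertices, it relates the numbers of elements of `L` all of whose neighbours are good, or all of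
whose neighbours except possibly the last one are good, to sums over the neighbours. -/
theorem double_count_neighbours {N : ℕ} (T : SimpleGraph (Fin N))
    (L : Finset (Fin N)) (hpos : ∀ u ∈ L, 1 ≤ T.degree u) (hdeg : ∀ u ∈ L, T.degree u ≤ 2)
    (p : Fin N → Prop) :
    (∑ i, if p i then (L.filter fun u => T.Adj u i ∧ (∀ a, T.Adj u a → a ≤ i) ∧
        ∀ a < i, T.Adj u a → p a).card else 0) ≤ (L.filter fun u => ∀ a, T.Adj u a → p a).card ∧
    L.card + (∑ i, if p i then (L.filter fun u => T.Adj u i ∧ ∃ a, T.Adj u a ∧ i < a).card else 0)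
      ≤ (∑ i, (L.filter fun u => T.Adj u i ∧ ∃ a, T.Adj u a ∧ i < a).card) +
        ∑ i, (L.filter fun u => T.Adj u i ∧ (∀ a, T.Adj u a → a ≤ i) ∧
        ∀ a < i, T.Adj u a → p a).card ∧
    (∑ i, (L.filter fun u => T.Adj u i ∧ ∃ a, T.Adj u a ∧ i < a).card) ≤ L.card := by
  have dc : ∀ (Q : Fin N → Fin N → Prop) [∀ u i, Decidable (Q u i)], ∑ i, (L.filter fun u => Q u i).card
      = ∑ u ∈ L, (Finset.univ.filter fun i => Q u i).card := by
    intro Q _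
    simp_rw [Finset.card_filter]
    exact Finset.sum_comm
  have dc' : ∀ (Q : Fin N → Fin N → Prop) [∀ u i, Decidable (Q u i)],
      (∑ i, if p i then (L.filter fun u => Q u i).card else 0)
      = ∑ u ∈ L, (Finset.univ.filter fun i => p i ∧ Q u i).card := by
    intro Q _
    rw [← dc]
    refine Finset.sum_congr rfl fun i _ => ?_
    by_cases h : p i <;> simp [h]
  -- Call a neighbour of `u` early if `u` has a later one. With degree at most 2 there is at most
  -- one early neighbour.
  have hearly : ∀ u ∈ L, ∀ a b, T.Adj u a → T.Adj u b → (∃ c, T.Adj u c ∧ a < c) →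
      (∃ c, T.Adj u c ∧ b < c) → a = b := by
    rintro u hu a b ha hb ⟨c, hc, hac⟩ ⟨d, hd, hbd⟩
    by_contra hab
    have hthree : ∀ y, T.Adj u y → y ≠ a → y ≠ b → False := by
      intro y hy hya hyb
      have h3 : ({a, b, y} : Finset (Fin N)) ⊆ T.neighborFinset u := by
        intro z hz
        simp only [Finset.mem_insert, Finset.mem_singleton] at hz
        rw [mem_neighborFinset]
        rcases hz with rfl | rfl | rfl <;> assumption
      have h4 := Finset.card_le_card h3
      rw [card_neighborFinset_eq_degree, Finset.card_eq_three.mpr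
        ⟨a, b, y, hab, hya.symm, hyb.symm, rfl⟩] at h4
      have := hdeg u hu
      omega
    rcases lt_or_gt_of_ne hab with h | h
    · exact hthree d hd (h.trans hbd).ne' hbd.ne'
    · exact hthree c hc hac.ne' (h.trans hac).ne'
  refine ⟨?_, ?_, ?_⟩
  · rw [dc', Finset.card_filter]
    refine Finset.sum_le_sum fun u _ => ?_
    split_ifs with h
    · rw [Finset.card_le_one]
      intro i hi j hj
      simp only [Finset.mem_filter, Finset.mem_univ, true_and] at hi hj
      exact le_antisymm (hj.2.2.1 i hi.2.1) (hi.2.2.1 j hj.2.1)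
    · rw [Nat.le_zero, Finset.card_eq_zero, Finset.filter_eq_empty_iff]
      rintro i - ⟨hpi, hui, hlast, hall⟩
      refine h fun a ha => ?_
      rcases (hlast a ha).lt_or_eq with h' | h'
      · exact hall a h' ha
      · rwa [h']
  · rw [dc', dc, dc, Finset.card_eq_sum_ones, ← Finset.sum_add_distrib, ← Finset.sum_add_distrib]
    refine Finset.sum_le_sum fun u hu => ?_
    set E := Finset.univ.filter fun i => T.Adj u i ∧ ∃ a, T.Adj u a ∧ i < a
    have hsub : (Finset.univ.filter fun i => p i ∧ T.Adj u i ∧ ∃ a, T.Adj u a ∧ i < a) ⊆ E := by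
      intro i hi
      simp only [E, Finset.mem_filter, Finset.mem_univ, true_and] at hi ⊢
      exact hi.2
    -- If all early neighbours are good, the last neighbour supplies the extra 1; otherwise a bad
    -- early neighbour does.
    by_cases hall : ∀ i ∈ E, p i
    · have h1 := Finset.card_le_card hsub
      have h2 : (T.neighborFinset u).Nonempty := by
        rw [← Finset.card_pos, card_neighborFinset_eq_degree]
        exact hpos u hu
      have h3 : 0 < (Finset.univ.filter fun i => T.Adj u i ∧ (∀ a, T.Adj u a → a ≤ i) ∧
          ∀ a < i, T.Adj u a → p a).card := by
        rw [Finset.card_pos]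
        have hmem := (T.neighborFinset u).max'_mem h2
        rw [mem_neighborFinset] at hmem
        refine ⟨(T.neighborFinset u).max' h2, ?_⟩
        simp only [Finset.mem_filter, Finset.mem_univ, true_and]
        refine ⟨hmem, fun a ha => Finset.le_max' _ _ (by simpa using ha), fun a hlt ha => ?_⟩
        exact hall a (by
          simp only [E, Finset.mem_filter, Finset.mem_univ, true_and]
          exact ⟨ha, _, hmem, hlt⟩)
      omega
    · push Not at hall
      obtain ⟨i, hi, hpi⟩ := hall
      have h1 := Finset.card_lt_card ((Finset.ssubset_iff_of_subset hsub).mpr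
        ⟨i, hi, fun h => hpi (Finset.mem_filter.mp h).2.1⟩)
      omega
  · rw [dc, Finset.card_eq_sum_ones]
    refine Finset.sum_le_sum fun u hu => ?_
    rw [Finset.card_le_one]
    intro i hi j hj
    simp only [Finset.mem_filter, Finset.mem_univ, true_and] at hi hj
    exact hearly u hu i j hi.1 hj.1 hi.2 hj.2

open Classical in
/-- Completing a partial embedding with Hall's theorem: `L` is an independent set of vertices that
are still to be embedded. -/
theorem isContained_of_partial_embedding {V : Type*} [Fintype V] (G : SimpleGraph V) {N : ℕ}
    (T : SimpleGraph (Fin N)) (hN : N ≤ Fintype.card V) (L : Finset (Fin N))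
    (hL : ∀ u ∈ L, ∀ v ∈ L, ¬ T.Adj u v) (x : Fin N → V)
    (hinj : ∀ i ∉ L, ∀ j ∉ L, x i = x j → i = j)
    (hadj : ∀ i ∉ L, ∀ j ∉ L, T.Adj i j → G.Adj (x i) (x j)) (g : ℕ)
    (hfew : ∀ u ∈ L, (Finset.univ.filter fun r => ¬ ∀ a, T.Adj u a → G.Adj (x a) r).card ≤ g)
    (hmany : ∀ r, g < (L.filter fun u => ∀ a, T.Adj u a → G.Adj (x a) r).card) : T ⊑ G := by
  set R : Finset V := Finset.univ \ Lᶜ.image x with hR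
  have hRcard : L.card ≤ R.card := by
    have h1 : _ ≤ R.card := Finset.le_card_sdiff (Lᶜ.image x) Finset.univ
    have h2 : (Lᶜ.image x).card ≤ Lᶜ.card := Finset.card_image_le
    have h3 := Finset.card_add_card_compl L
    rw [Fintype.card_fin] at h3
    rw [Finset.card_univ] at h1
    omega
  obtain ⟨f, hf, hfmem⟩ := (Finset.all_card_le_biUnion_card_iff_exists_injective
    (fun u : L => R.filter fun r => ∀ a, T.Adj u a → G.Adj (x a) r)).mp (by
      intro X
      rcases X.eq_empty_or_nonempty with rfl | ⟨u, hu⟩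
      · simp
      -- A small `X` is served by any one of its members. If `X` omits fewer than `g` elements of
      -- `L`, every `r ∈ R` fits some element of `X`.
      by_cases hX : X.card + g ≤ L.card
      · refine le_trans ?_ (Finset.card_le_card (Finset.subset_biUnion_of_mem _ hu))
        have h1 := Finset.card_filter_add_card_filter_not (s := R)
          (fun r => ∀ a, T.Adj u a → G.Adj (x a) r)
        have h2 := (Finset.card_le_card (Finset.filter_subset_filter
          (fun r => ¬ ∀ a, T.Adj u a → G.Adj (x a) r) (Finset.subset_univ R))).trans (hfew u u.2)
        omega
      · refine le_trans ?_ (Finset.card_le_card (s := R) fun r hr => ?_)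
        · have := Finset.card_le_univ X
          rw [Fintype.card_coe] at this
          omega
        · rw [Finset.mem_biUnion]
          by_contra hcon
          push Not at hcon
          have h1 := hmany r
          have h2 : (L.filter fun u => ∀ a, T.Adj u a → G.Adj (x a) r) ⊆
              L \ X.map (Function.Embedding.subtype _) := by
            intro v hv
            rw [Finset.mem_filter] at hv
            rw [Finset.mem_sdiff]
            refine ⟨hv.1, fun hvX => ?_⟩
            rw [Finset.mem_map] at hvX
            obtain ⟨y, hy, rfl⟩ := hvX
            exact hcon y hy (Finset.mem_filter.mpr ⟨hr, hv.2⟩)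
          have h3 := Finset.card_le_card h2
          rw [Finset.card_sdiff_of_subset (by
            intro v hv
            rw [Finset.mem_map] at hv
            obtain ⟨y, hy, rfl⟩ := hv
            exact y.2), Finset.card_map] at h3
          omega)
  have hfR : ∀ u, f u ∈ R := fun u => (Finset.mem_filter.mp (hfmem u)).1
  have hfadj : ∀ u : L, ∀ a, T.Adj u a → G.Adj (x a) (f u) :=
    fun u => (Finset.mem_filter.mp (hfmem u)).2
  have hfx : ∀ (u : L) (j), j ∉ L → f u ≠ x j := fun u j hj h => by
    have := hfR u
    rw [hR, Finset.mem_sdiff, h] at this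
    exact this.2 (Finset.mem_image_of_mem x (by simpa using hj))
  refine ⟨⟨⟨fun i => if h : i ∈ L then f ⟨i, h⟩ else x i, ?_⟩, ?_⟩⟩
  · intro i j hij
    by_cases hi : i ∈ L <;> by_cases hj : j ∈ L
    · exact absurd hij (hL i hi j hj)
    · simp only [hi, hj, dite_true, dite_false]
      exact (hfadj ⟨i, hi⟩ j hij).symm
    · simp only [hi, hj, dite_true, dite_false]
      exact hfadj ⟨j, hj⟩ i hij.symm
    · simp only [hi, hj, dite_false]
      exact hadj i hi j hj hij
  · intro i j hij
    change (if h : i ∈ L then f ⟨i, h⟩ else x i) = (if h : j ∈ L then f ⟨j, h⟩ else x j) at hij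
    by_cases hi : i ∈ L <;> by_cases hj : j ∈ L
    · simp only [hi, hj, dite_true] at hij
      exact congrArg Subtype.val (hf hij)
    · simp only [hi, hj, dite_true, dite_false] at hij
      exact absurd hij (hfx _ j hj)
    · simp only [hi, hj, dite_true, dite_false] at hij
      exact absurd hij.symm (hfx _ i hi)
    · simp only [hi, hj, dite_false] at hij
      exact hinj i hi j hj hij

end SimpleGraph

namespace SimpleGraph

open Classical in
/-- Embedding all of an ordered forest except an independent set `L` of vertices of degree 1 or 2,
avoiding a small set `S`, in such a way that every vertex `r` of `G` is adjacent to all images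
of the neighbours of many elements of `L₀ ⊆ L`. The neighbours of `L₀` are embedded into a reserved
set `U`. -/
theorem exists_partial_embedding {V : Type*} [Fintype V] [Nonempty V] (G : SimpleGraph V) {N : ℕ}
    (T : SimpleGraph (Fin N))
    (hT : ∀ i a b, T.Adj i a → T.Adj i b → a < i → b < i → a = b)
    (L L₀ : Finset (Fin N)) (hL : ∀ u ∈ L, ∀ v ∈ L, ¬ T.Adj u v) (hL₀ : L₀ ⊆ L)
    (hpos : ∀ u ∈ L, 1 ≤ T.degree u) (hdeg : ∀ u ∈ L, T.degree u ≤ 2)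
    (D : ℕ) (hD1 : 1 ≤ D) (hD : ∀ i, T.degree i ≤ D) (U S : Finset V) (g : ℕ) (q : ℝ)
    (hq0 : 0 ≤ q) (hq2 : q ≤ 2)
    (hS : ∀ v ∉ S, (Finset.univ.filter fun y => ¬ G.Adj v y).card ≤ g)
    (hUc : N + g + S.card < L.card + Uᶜ.card) (hU : 2 * L₀.card + g + S.card < U.card)
    (hUr : ∀ r, 2 * L₀.card + g + S.card + q * U.card
      ≤ ((U.filter fun y => G.Adj y r).card : ℝ)) :
    ∃ x : Fin N → V, (∀ i ∉ L, x i ∉ S) ∧ (∀ i ∉ L, ∀ j ∉ L, x i = x j → i = j) ∧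
      (∀ i ∉ L, ∀ j ∉ L, T.Adj i j → G.Adj (x i) (x j)) ∧
      ∀ r, q / 2 * (q / 2 * L₀.card - D * Real.log (2 * Fintype.card V))
        - D * Real.log (2 * Fintype.card V)
        ≤ ((L₀.filter fun u => ∀ a, T.Adj u a → G.Adj (x a) r).card : ℝ) := by
  -- Indices in `L` get dummy values, never used later. `U` is kept exclusively for neighbours of
  -- `L₀`, so at most `2 * L₀.card` of it is ever occupied.
  set cand : (Fin N → V) → Fin N → Finset V := fun x i =>
    if i ∈ L then Finset.univ else Finset.univ.filter fun v =>
      (v ∈ U ↔ ∃ u ∈ L₀, T.Adj u i) ∧ v ∉ S ∧ (∀ j < i, j ∉ L → x j ≠ v) ∧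
        ∀ j < i, j ∉ L → T.Adj i j → G.Adj (x j) v with hcand
  have hmem : ∀ x i v, i ∉ L → (v ∈ cand x i ↔ (v ∈ U ↔ ∃ u ∈ L₀, T.Adj u i) ∧ v ∉ S ∧
      (∀ j < i, j ∉ L → x j ≠ v) ∧ ∀ j < i, j ∉ L → T.Adj i j → G.Adj (x j) v) := by
    intro x i v hi
    simp [hcand, hi]
  set n₀ : Fin N → ℕ := fun i =>
    (L₀.filter fun u => T.Adj u i ∧ ∃ a, T.Adj u a ∧ i < a).card with hn₀
  set n₁ : V → (Fin N → V) → Fin N → ℕ := fun r x i =>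
    (L₀.filter fun u => T.Adj u i ∧ (∀ a, T.Adj u a → a ≤ i) ∧
      ∀ a < i, T.Adj u a → G.Adj (x a) r).card with hn₁
  have hle : ∀ i (Q : Fin N → Prop) [DecidablePred Q], (∀ u, Q u → T.Adj u i) → (L₀.filter Q).card ≤ D := by
    intro i Q _ hQ
    refine le_trans (Finset.card_le_card fun u hu => ?_)
      ((T.card_neighborFinset_eq_degree i).le.trans (hD i))
    rw [mem_neighborFinset]
    exact (hQ u (Finset.mem_filter.mp hu).2).symm
  have hn₀D : ∀ i, n₀ i ≤ D := by
    intro i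
    simp only [hn₀]
    exact hle i _ fun u hu => hu.1
  have hn₁D : ∀ r x i, n₁ r x i ≤ D := by
    intro r x i
    simp only [hn₁]
    exact hle i _ fun u hu => hu.1
  have hempty : ∀ i, (¬ ∃ u ∈ L₀, T.Adj u i) → ∀ (Q : Fin N → Prop) [DecidablePred Q],
      (∀ u, Q u → T.Adj u i) → (L₀.filter Q).card = 0 := by
    intro i hi Q _ hQ
    rw [Finset.card_eq_zero, Finset.filter_eq_empty_iff]
    exact fun u hu hQu => hi ⟨u, hu, hQ u hQu⟩
  have hDpos : (0 : ℝ) < D := by exact_mod_cast hD1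
  -- Two tests per vertex `r`: `false` counts early neighbours, `true` counts last neighbours whose
  -- predecessors already landed in `N(r)`. The latter depends on earlier choices, hence the
  -- adaptive weights; dividing by `D` brings them into `[0, 1]`.
  set w : V × Bool → (Fin N → V) → Fin N → ℝ := fun r x i =>
    (if r.2 then (n₁ r.1 x i : ℝ) else n₀ i) / D with hw
  have hsep : ∀ i ∈ L, ¬ ∃ u ∈ L₀, T.Adj u i := fun i hi ⟨u, hu, hui⟩ => hL u (hL₀ hu) i hi hui
  have hbad : ∀ x i, i ∉ L → (∀ j < i, x j ∈ cand x j) → ∃ bad : Finset V, bad.card ≤ g ∧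
      ∀ v ∉ bad, ∀ j < i, j ∉ L → T.Adj i j → G.Adj (x j) v := by
    intro x i hi hx
    by_cases h : ∃ j, j < i ∧ j ∉ L ∧ T.Adj i j
    · obtain ⟨j, hj, hjL, hij⟩ := h
      refine ⟨_, hS (x j) ((hmem x j (x j) hjL).mp (hx j hj)).2.1, ?_⟩
      intro v hv l hl _ hil
      rw [hT i l j hil hij hl hj]
      simpa using hv
    · exact ⟨∅, by simp, fun v _ j hj hjL hij => absurd ⟨j, hj, hjL, hij⟩ h⟩
  have hcandU : ∀ x i, i ∉ L → (∃ u ∈ L₀, T.Adj u i) → (∀ j < i, x j ∈ cand x j) →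
      cand x i ⊆ U ∧ ∃ X : Finset V, X.card ≤ 2 * L₀.card + g + S.card ∧ U \ X ⊆ cand x i := by
    intro x i hi hiN hx
    obtain ⟨bad, hbadc, hbad⟩ := hbad x i hi hx
    refine ⟨fun v hv => ((hmem x i v hi).mp hv).1.mpr hiN,
      (L₀.biUnion fun u => T.neighborFinset u).image x ∪ bad ∪ S, ?_, ?_⟩
    · refine (Finset.card_union_le _ _).trans (add_le_add_left ?_ _)
      refine (Finset.card_union_le _ _).trans (add_le_add ?_ hbadc)
      refine Finset.card_image_le.trans ?_
      rw [mul_comm]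
      exact Finset.card_biUnion_le_card_mul _ _ _ fun u hu =>
        (T.card_neighborFinset_eq_degree u).le.trans (hdeg u (hL₀ hu))
    · intro v hv
      simp only [Finset.mem_sdiff, Finset.mem_union, not_or] at hv
      obtain ⟨hvU, ⟨hvx, hvb⟩, hvS⟩ := hv
      refine (hmem x i v hi).mpr ⟨⟨fun _ => hiN, fun _ => hvU⟩, hvS, ?_, hbad v hvb⟩
      rintro j hj hjL rfl
      obtain ⟨u, hu, huj⟩ := ((hmem x j (x j) hjL).mp (hx j hj)).1.mp hvU
      exact hvx (Finset.mem_image_of_mem x (Finset.mem_biUnion.mpr ⟨u, hu, by simpa using huj⟩))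
  have hcardR : (Fintype.card (V × Bool) : ℝ) = 2 * Fintype.card V := by
    rw [Fintype.card_prod, Fintype.card_bool]; push_cast; ring
  obtain ⟨x, hx, hsum⟩ := exists_adaptive_sequence (R := V × Bool) N cand
    (fun r v => G.Adj v r.1) w q
    (by
      intro x y i h
      simp only [hcand]
      split_ifs
      · rfl
      · refine Finset.filter_congr fun v _ => ?_
        refine and_congr Iff.rfl (and_congr Iff.rfl (and_congr ?_ ?_)) <;>
        refine forall_congr' fun j => forall_congr' fun hj => by rw [h j hj])
    (by
      intro r x y i h
      have : n₁ r.1 x i = n₁ r.1 y i := by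
        simp only [hn₁]
        refine congrArg Finset.card (Finset.filter_congr fun u _ => ?_)
        refine and_congr Iff.rfl (and_congr Iff.rfl ?_)
        refine forall_congr' fun j => forall_congr' fun hj => by rw [h j hj]
      simp only [hw, this])
    (by
      intro r x i
      simp only [hw]
      split_ifs <;> positivity)
    (by
      intro r x i
      simp only [hw]
      rw [div_le_one hDpos]
      split_ifs
      · exact_mod_cast hn₁D _ _ _
      · exact_mod_cast hn₀D _)
    (by
      intro x i hx
      by_cases hi : i ∈ L
      · simp [hcand, hi]
      by_cases hiN : ∃ u ∈ L₀, T.Adj u i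
      · obtain ⟨-, X, hX, hsub⟩ := hcandU x i hi hiN hx
        have := (Finset.le_card_sdiff X U).trans (Finset.card_le_card hsub)
        exact Finset.card_pos.mp (by omega)
      · obtain ⟨bad, hbadc, hbad⟩ := hbad x i hi hx
        obtain ⟨v, hv, hv'⟩ : ∃ v ∈ Uᶜ, v ∉ Lᶜ.image x ∪ bad ∪ S := by
          apply Finset.exists_mem_notMem_of_card_lt_card
          have h1 := Finset.card_union_le (Lᶜ.image x ∪ bad) S
          have h2 := Finset.card_union_le (Lᶜ.image x) bad
          have h3 : (Lᶜ.image x).card ≤ Lᶜ.card := Finset.card_image_le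
          have h4 := Finset.card_add_card_compl L
          rw [Fintype.card_fin] at h4
          omega
        simp only [Finset.mem_union, not_or] at hv'
        rw [Finset.mem_compl] at hv
        refine ⟨v, (hmem x i v hi).mpr
          ⟨⟨fun h => absurd h hv, fun h => absurd h hiN⟩, hv'.2, ?_, hbad v hv'.1.2⟩⟩
        rintro j hj hjL rfl
        exact hv'.1.1 (Finset.mem_image_of_mem x (by simpa using hjL)))
    (by
      intro x i hx r
      by_cases hiN : ∃ u ∈ L₀, T.Adj u i
      · right
        have hi : i ∉ L := fun hi => hsep i hi hiN
        obtain ⟨hsubU, X, hX, hsub⟩ := hcandU x i hi hiN hx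
        have h1 : (U.filter fun y => G.Adj y r.1) \ X ⊆
            (cand x i).filter fun v => G.Adj v r.1 := by
          intro v hv
          rw [Finset.mem_sdiff, Finset.mem_filter] at hv
          exact Finset.mem_filter.mpr ⟨hsub (Finset.mem_sdiff.mpr ⟨hv.1.1, hv.2⟩), hv.1.2⟩
        have h2 := (Finset.le_card_sdiff _ _).trans (Finset.card_le_card h1)
        have h3 : (U.filter fun y => G.Adj y r.1).card ≤
            ((cand x i).filter fun v => G.Adj v r.1).card + (2 * L₀.card + g + S.card) := by
          omega
        have h4 : ((U.filter fun y => G.Adj y r.1).card : ℝ) ≤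
            ((cand x i).filter fun v => G.Adj v r.1).card + (2 * L₀.card + g + S.card) := by
          exact_mod_cast h3
        have h5 : ((cand x i).card : ℝ) ≤ U.card := by exact_mod_cast Finset.card_le_card hsubU
        have h6 := mul_le_mul_of_nonneg_left h5 hq0
        linarith [hUr r.1]
      · left
        simp only [hw, hn₀, hn₁]
        rw [hempty i hiN _ fun u hu => hu.1, hempty i hiN _ fun u hu => hu.1]
        simp)
  have hx' := fun i (hi : i ∉ L) => (hmem x i (x i) hi).mp (hx i)
  refine ⟨x, fun i hi => (hx' i hi).2.1, ?_, ?_, ?_⟩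
  · intro i hi j hj hij
    by_contra hne
    rcases lt_or_gt_of_ne hne with h | h
    · exact (hx' j hj).2.2.1 i h hi hij
    · exact (hx' i hi).2.2.1 j h hj hij.symm
  · intro i hi j hj hij
    rcases lt_trichotomy i j with h | h | h
    · exact (hx' j hj).2.2.2 i h hi hij.symm
    · exact absurd h hij.ne
    · exact ((hx' i hi).2.2.2 j h hj hij).symm
  · intro r
    obtain ⟨h1, h2, h3⟩ := double_count_neighbours T L₀ (fun u hu => hpos u (hL₀ hu))
      (fun u hu => hdeg u (hL₀ hu)) (fun i => G.Adj (x i) r)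
    have s0 := hsum (r, false)
    have s1 := hsum (r, true)
    rw [hcardR] at s0 s1
    have e0 : ∑ i, w (r, false) x i = (∑ i, n₀ i : ℕ) / D := by
      simp [hw, Finset.sum_div]
    have e1 : ∑ i, w (r, true) x i = (∑ i, n₁ r x i : ℕ) / D := by
      simp [hw, Finset.sum_div]
    have f0 : (∑ i, if G.Adj (x i) r then w (r, false) x i else 0)
        = (∑ i, if G.Adj (x i) r then n₀ i else 0 : ℕ) / D := by
      push_cast
      rw [Finset.sum_div]
      refine Finset.sum_congr rfl fun i _ => ?_
      split_ifs <;> simp [hw]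
    have f1 : (∑ i, if G.Adj (x i) r then w (r, true) x i else 0)
        = (∑ i, if G.Adj (x i) r then n₁ r x i else 0 : ℕ) / D := by
      push_cast
      rw [Finset.sum_div]
      refine Finset.sum_congr rfl fun i _ => ?_
      split_ifs <;> simp [hw]
    simp only [e0, f0] at s0
    simp only [e1, f1] at s1
    change (∑ i, if G.Adj (x i) r then n₁ r x i else 0) ≤ _ at h1
    change L₀.card + (∑ i, if G.Adj (x i) r then n₀ i else 0)
      ≤ (∑ i, n₀ i) + ∑ i, n₁ r x i at h2
    change ∑ i, n₀ i ≤ _ at h3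
    have h1' : ((∑ i, if G.Adj (x i) r then n₁ r x i else 0 : ℕ) : ℝ) ≤
      (L₀.filter fun u => ∀ a, T.Adj u a → G.Adj (x a) r).card := by exact_mod_cast h1
    have h2' : (L₀.card : ℝ) + (∑ i, if G.Adj (x i) r then n₀ i else 0 : ℕ)
      ≤ (∑ i, n₀ i : ℕ) + (∑ i, n₁ r x i : ℕ) := by exact_mod_cast h2
    have h3' : ((∑ i, n₀ i : ℕ) : ℝ) ≤ L₀.card := by exact_mod_cast h3
    generalize (∑ i, if G.Adj (x i) r then n₁ r x i else 0 : ℕ) = y1 at *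
    generalize (∑ i, if G.Adj (x i) r then n₀ i else 0 : ℕ) = y0 at *
    generalize (∑ i, n₀ i : ℕ) = z0 at *
    generalize (∑ i, n₁ r x i : ℕ) = z1 at *
    have t0 : q / 2 * z0 - D * Real.log (2 * Fintype.card V) ≤ y0 := by
      have := mul_le_mul_of_nonneg_right s0 hDpos.le
      rw [div_mul_cancel₀ _ hDpos.ne', sub_mul, mul_assoc, div_mul_cancel₀ _ hDpos.ne'] at this
      linarith
    have t1 : q / 2 * z1 - D * Real.log (2 * Fintype.card V) ≤ y1 := by
      have := mul_le_mul_of_nonneg_right s1 hDpos.le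
      rw [div_mul_cancel₀ _ hDpos.ne', sub_mul, mul_assoc, div_mul_cancel₀ _ hDpos.ne'] at this
      linarith
    -- Since `z1 ≥ L₀.card - z0 + y0`, the first test leaves about `q / 2` of `L₀` eligible for the
    -- second, which keeps `q / 2` of those.
    have t2 : (1 - q / 2) * z0 ≤ (1 - q / 2) * L₀.card :=
      mul_le_mul_of_nonneg_left h3' (by linarith)
    have t3 : q / 2 * L₀.card - D * Real.log (2 * Fintype.card V) ≤ z1 := by linarith
    have t4 := mul_le_mul_of_nonneg_left t3 (show 0 ≤ q / 2 by linarith)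
    linarith

end SimpleGraph

/-! ### Part (a): numerical estimates and assembly. -/

theorem log_two_mul_le_sqrt {n : ℝ} (hn : 10 ^ 11 ≤ n) :
    Real.log (2 * n) ≤ Real.sqrt n / 10 ^ 4 := by
  have hs : 316227 ≤ Real.sqrt n := Real.le_sqrt_of_sq_le (by linarith)
  have h0 : 0 < Real.sqrt n := by linarith
  have h1 : Real.log (2 * n) = Real.log 2 + 2 * Real.log (Real.sqrt n) := by
    rw [Real.log_mul (by norm_num) (by linarith), Real.log_sqrt (by linarith)]; ring
  -- Tangent line of `log` at `2 ^ 18 = 262144`, a power of 2 just below the least possible `√n`.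
  have h2 : Real.log (Real.sqrt n) = Real.log (Real.sqrt n / 2 ^ 18) + 18 * Real.log 2 := by
    rw [Real.log_div h0.ne' (by norm_num), Real.log_pow]; norm_num
  have h3 := Real.log_le_sub_one_of_pos (show 0 < Real.sqrt n / 2 ^ 18 by positivity)
  have h4 := Real.log_two_lt_d9
  rw [h1, h2]
  linarith

namespace SimpleGraph

/-- Every tree with at least one edge has an independent set consisting of a quarter of its
vertices, all of degree 1 or 2. -/
theorem IsTree.exists_independent_degree_le_two {W : Type*} [Fintype W] [Nontrivial W]
    {T : SimpleGraph W} [DecidableRel T.Adj] (hT : T.IsTree) :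
    ∃ L : Finset W, Fintype.card W ≤ 4 * L.card ∧ (∀ u ∈ L, ∀ v ∈ L, ¬ T.Adj u v) ∧
      ∀ u ∈ L, T.degree u ≤ 2 := by
  obtain ⟨c⟩ := hT.colorable_two
  set F := Finset.univ.filter fun v => T.degree v ≤ 2 with hF
  have h1 : Fintype.card W ≤ 2 * F.card := hT.card_le_two_mul_card_degree_le_two
  have h2 := Finset.card_filter_add_card_filter_not (s := F) (fun v => c v = 0)
  have hdeg : ∀ u ∈ F, T.degree u ≤ 2 := fun u hu => (Finset.mem_filter.mp hu).2
  rcases le_total (F.filter fun v => c v = 0).card (F.filter fun v => ¬ c v = 0).card with h | h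
  · refine ⟨F.filter fun v => ¬ c v = 0, by omega, fun u hu v hv huv => ?_,
      fun u hu => hdeg u (Finset.mem_filter.mp hu).1⟩
    have := c.valid huv
    have hu := (Finset.mem_filter.mp hu).2
    have hv := (Finset.mem_filter.mp hv).2
    omega
  · refine ⟨F.filter fun v => c v = 0, by omega, fun u hu v hv huv => ?_,
      fun u hu => hdeg u (Finset.mem_filter.mp hu).1⟩
    exact c.valid huv ((Finset.mem_filter.mp hu).2.trans (Finset.mem_filter.mp hv).2.symm)

/-- The number of vertices with more than `g` non-neighbours (including themselves), in a graph
with average degree more than `k - 1`. -/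
theorem card_filter_degree_lt_mul_le {V : Type*} [Fintype V] [Nonempty V] (G : SimpleGraph V)
    [DecidableRel G.Adj] {k : ℝ} (hd : k - 1 < averageDegree G) (g : ℕ) :
    ((Finset.univ.filter fun v => g + G.degree v < Fintype.card V).card : ℝ) * g ≤
      Fintype.card V * (Fintype.card V - k) := by
  have hpos : (0 : ℝ) < Fintype.card V := by exact_mod_cast Fintype.card_pos
  have h1 : ∑ v : V, ((Fintype.card V : ℝ) - 1 - G.degree v) ≤
      Fintype.card V * (Fintype.card V - k) := by
    rw [Finset.sum_sub_distrib, ← averageDegree_mul_card]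
    simp only [Finset.sum_const, nsmul_eq_mul, Finset.card_univ]
    have := mul_lt_mul_of_pos_right hd hpos
    linarith
  refine le_trans ?_ h1
  rw [← nsmul_eq_mul, ← Finset.sum_const]
  refine le_trans (Finset.sum_le_sum fun v hv => ?_)
    (Finset.sum_le_sum_of_subset_of_nonneg (Finset.filter_subset _ _) fun v _ _ => ?_)
  · have h2 : g + G.degree v + 1 ≤ Fintype.card V := (Finset.mem_filter.mp hv).2
    have h3 : (g : ℝ) + G.degree v + 1 ≤ Fintype.card V := by exact_mod_cast h2
    linarith
  · have h2 : G.degree v + 1 ≤ Fintype.card V := G.degree_lt_card_verts v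
    have h3 : (G.degree v : ℝ) + 1 ≤ Fintype.card V := by exact_mod_cast h2
    linarith

end SimpleGraph

open SimpleGraph

open Classical in
/-- Trees with small maximum degree in graphs that are barely larger than the tree. -/
theorem isContained_of_card_le {V : Type*} [Fintype V]
    (G : SimpleGraph V) (k : ℕ) (hd : (k : ℝ) - 1 < averageDegree G)
    (hδ : (k : ℝ) / 2 ≤ (G.minDegree : ℝ)) (hk : 0 < k)
    (hn : (Fintype.card V : ℝ) ≤ (1 + 1 / (10 : ℝ) ^ 11) * (k : ℝ))
    {W : Type*} [Fintype W] [DecidableEq W] (T : SimpleGraph W) [DecidableRel T.Adj]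
    (hT : IsTreeOfClass T k (Real.sqrt (k : ℝ) / 1000)) : T ⊑ G := by
  obtain ⟨htree, hedges, hmax⟩ := hT
  have hcW : Fintype.card W = k + 1 := by rw [← hedges, htree.card_edgeFinset]
  have hk0 : (1 : ℝ) ≤ k := by exact_mod_cast hk
  have hV : Nonempty V := by
    by_contra hcon
    rw [not_nonempty_iff] at hcon
    simp only [averageDegree, Finset.univ_eq_empty, Finset.sum_empty, zero_div] at hd
    linarith
  set n := Fintype.card V with hndef
  have hnpos : (0 : ℝ) < n := by exact_mod_cast Fintype.card_pos
  have hkn : k + 1 ≤ n := by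
    have h1 : (k : ℝ) - 1 < n - 1 := by
      refine hd.trans_le ?_
      unfold averageDegree
      rw [div_le_iff₀ hnpos]
      refine (Finset.sum_le_card_nsmul _ _ ((n : ℝ) - 1) fun v _ => ?_).trans ?_
      · have h2 : G.degree v + 1 ≤ n := G.degree_lt_card_verts v
        have h3 : (G.degree v : ℝ) + 1 ≤ n := by exact_mod_cast h2
        linarith
      · rw [nsmul_eq_mul, Finset.card_univ, mul_comm]
    have h2 : (k : ℝ) < n := by linarith
    exact_mod_cast h2
  have hkn' : (k : ℝ) + 1 ≤ n := by exact_mod_cast hkn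
  -- `k + 1 ≤ n ≤ (1 + 10⁻¹¹) k` leaves room for the extra vertex only if `k` is this large.
  have hk11 : (10 : ℝ) ^ 11 ≤ k := by
    have h1 : (1 : ℝ) ≤ 1 / 10 ^ 11 * k := by linarith
    rw [one_div_mul_eq_div, le_div_iff₀ (by norm_num)] at h1
    linarith
  have hn11 : (10 : ℝ) ^ 11 ≤ n := by linarith
  have hdegG : ∀ r, (k : ℝ) / 2 ≤ G.degree r := fun r =>
    hδ.trans (by exact_mod_cast G.minDegree_le_degree r)
  have hlog := log_two_mul_le_sqrt hn11
  have hsq : Real.sqrt n * Real.sqrt n = n := Real.mul_self_sqrt hnpos.le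
  have hsqn : Real.sqrt n ≤ n / 300000 := by
    have : 300000 ≤ Real.sqrt n := Real.le_sqrt_of_sq_le (by linarith)
    nlinarith
  have hlog0 : 0 ≤ Real.log (2 * n) := Real.log_nonneg (by linarith)
  have hlogn : Real.log n ≤ n / 10 ^ 9 := by
    have : Real.log n ≤ Real.log (2 * n) := Real.log_le_log hnpos (by linarith)
    linarith
  have hDlog : T.maxDegree * Real.log (2 * n) ≤ n / 10 ^ 7 := by
    have h1 : Real.sqrt k / 1000 ≤ Real.sqrt n / 1000 := by
      have := Real.sqrt_le_sqrt (show (k : ℝ) ≤ n by linarith)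
      linarith
    have h2 := mul_le_mul (hmax.trans h1) hlog hlog0 (by positivity)
    refine h2.trans (le_of_eq ?_)
    rw [div_mul_div_comm, hsq]; norm_num
  obtain ⟨T', ⟨φ⟩, hT'⟩ := htree.exists_iso_fin hcW
  have htree' : T'.IsTree := φ.isTree_iff.mp htree
  have : Nontrivial (Fin (k + 1)) := Fin.nontrivial_iff_two_le.mpr (by omega)
  obtain ⟨L, hLcard, hLind, hLdeg⟩ := htree'.exists_independent_degree_le_two
  rw [Fintype.card_fin] at hLcard
  have hpos : ∀ u, 1 ≤ T'.degree u := fun u => htree'.1.preconnected.degree_pos_of_nontrivial u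
  have hD : ∀ i, T'.degree i ≤ T.maxDegree := fun i => by
    rw [← φ.symm.degree_eq i]
    exact T.degree_le_maxDegree _
  set g := n / 10 ^ 7 + 1 with hg
  set S := Finset.univ.filter fun v => g + G.degree v < n with hSdef
  have hS : ∀ v ∉ S, (Finset.univ.filter fun y => ¬ G.Adj v y).card ≤ g := by
    intro v hv
    have h1 : n ≤ g + G.degree v := by simpa [hSdef] using hv
    have h2 := Finset.card_filter_add_card_filter_not (s := Finset.univ) (G.Adj v)
    rw [← neighborFinset_eq_filter, card_neighborFinset_eq_degree, Finset.card_univ] at h2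
    omega
  have hfl : ∀ m : ℕ, 0 < m → (n : ℝ) / m - 1 ≤ (n / m : ℕ) ∧ ((n / m : ℕ) : ℝ) ≤ n / m := by
    intro m hm
    refine ⟨?_, Nat.cast_div_le⟩
    have h1 : n < m * (n / m + 1) := Nat.lt_mul_div_succ n hm
    have h2 : (n : ℝ) < m * ((n / m : ℕ) + 1) := by exact_mod_cast h1
    have hm' : (0 : ℝ) < m := by exact_mod_cast hm
    have := (div_lt_iff₀' hm').mpr h2
    linarith
  obtain ⟨g1, g2⟩ := hfl (10 ^ 7) (by norm_num)
  obtain ⟨s1, s2⟩ := hfl 20 (by norm_num)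
  obtain ⟨l1, l2⟩ := hfl 2000 (by norm_num)
  have hg' : (g : ℝ) = (n / 10 ^ 7 : ℕ) + 1 := by rw [hg]; push_cast; rfl
  have hScard : (S.card : ℝ) ≤ n / 10 ^ 4 := by
    have h1 := card_filter_degree_lt_mul_le G hd g
    have h2 : (n : ℝ) / 10 ^ 7 ≤ g := by rw [hg']; push_cast at g1; linarith
    have h3 := (mul_le_mul_of_nonneg_left h2 (Nat.cast_nonneg S.card)).trans h1
    have h4 : (S.card : ℝ) / 10 ^ 7 ≤ n - k := by
      refine le_of_mul_le_mul_left ?_ hnpos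
      calc (n : ℝ) * (S.card / 10 ^ 7) = S.card * (n / 10 ^ 7) := by ring
        _ ≤ _ := h3
    linarith
  -- Degrees are at least `k / 2`, above `2n / 5 + n / 20`. Every `r` thus gets about `n / 100`
  -- neighbours in `U`, while the later demand, with `q = 1 / 10` and `|L₀|` about `n / 2000`, is
  -- about `0.0061 n`.
  obtain ⟨U, hUcard, hUr⟩ := G.exists_balanced_subset (n / 20) (2 / 5) (Nat.div_le_self _ _)
    (by norm_num) (by
      intro r
      have := hdegG r
      push_cast at s2
      linarith)
  have hLcard' : (k : ℝ) + 1 ≤ 4 * L.card := by exact_mod_cast hLcard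
  push_cast at g1 g2 s1 s2 l1 l2
  obtain ⟨L₀, hL₀, hL₀card⟩ := Finset.exists_subset_card_eq (s := L) (n := n / 2000) (by
    have : ((n / 2000 : ℕ) : ℝ) ≤ L.card := by linarith
    exact_mod_cast this)
  have hL₀' : (L₀.card : ℝ) = (n / 2000 : ℕ) := by rw [hL₀card]
  have hU' : (U.card : ℝ) = (n / 20 : ℕ) := by rw [hUcard]
  have hUc : (U.card : ℝ) + Uᶜ.card = n := by exact_mod_cast Finset.card_add_card_compl U
  obtain ⟨x, hxS, hinj, hadj, hslots⟩ := G.exists_partial_embedding T' hT' L L₀ hLind hL₀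
    (fun u _ => hpos u) hLdeg T.maxDegree ((hpos 0).trans (hD 0)) hD U S g (1 / 10) (by norm_num)
    (by norm_num) hS (by
      have : ((k + 1 : ℕ) : ℝ) + g + S.card < L.card + Uᶜ.card := by push_cast; linarith
      exact_mod_cast this) (by
      have : 2 * (L₀.card : ℝ) + g + S.card < U.card := by linarith
      exact_mod_cast this) (by
      intro r
      have := hUr r
      linarith)
  have hresult : T' ⊑ G := by
    refine G.isContained_of_partial_embedding T' hkn L hLind x hinj hadj (2 * g) ?_ ?_
    · intro u hu
      refine le_trans (Finset.card_le_card (t := (T'.neighborFinset u).biUnion fun a =>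
        Finset.univ.filter fun r => ¬ G.Adj (x a) r) ?_) ?_
      · intro r hr
        simp only [Finset.mem_filter, Finset.mem_univ, true_and, not_forall] at hr
        obtain ⟨a, ha, hra⟩ := hr
        simp only [Finset.mem_biUnion, Finset.mem_filter, Finset.mem_univ, true_and]
        exact ⟨a, by simpa using ha, hra⟩
      · refine (Finset.card_biUnion_le_card_mul _ _ g fun a ha => ?_).trans ?_
        · rw [mem_neighborFinset] at ha
          exact hS _ (hxS a fun haL => hLind u hu a haL ha)
        · rw [card_neighborFinset_eq_degree]
          exact Nat.mul_le_mul_right g (hLdeg u hu)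
    · intro r
      refine lt_of_lt_of_le ?_ (Finset.card_le_card (Finset.filter_subset_filter _ hL₀))
      have h1 := hslots r
      -- The main term is `(1 / 20) ^ 2 * n / 2000 = n / 800000`; the logarithmic errors and `2 * g`
      -- are of order `n / 10 ^ 7`.
      have h2 : ((2 * g : ℕ) : ℝ) < (L₀.filter fun u => ∀ a, T'.Adj u a → G.Adj (x a) r).card := by
        refine lt_of_lt_of_le ?_ h1
        push_cast
        linarith
      exact_mod_cast h2
  exact φ.isContained.trans hresult

theorem theorem1p2 {V : Type*} [Fintype V] [DecidableEq V] (G : SimpleGraph V)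
    [DecidableRel G.Adj] (k : ℕ)
    (hd : (k : ℝ) - 1 < averageDegree G) (hδ : (k : ℝ) / 2 ≤ (G.minDegree : ℝ)) :
    (10 ^ 6 ≤ k →
      (Fintype.card V : ℝ) ≤ (1 + 1 / (10 : ℝ) ^ 11) * (k : ℝ) →
      ∀ (W : Type*) [Fintype W] [DecidableEq W] (T : SimpleGraph W) [DecidableRel T.Adj],
        IsTreeOfClass T k (Real.sqrt (k : ℝ) / 1000) → T ⊑ G) ∧
    (∀ Δ : ℕ, 1 ≤ Δ → 8 * Δ ^ 2 ≤ k →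
      ∀ A B : Finset V, IsBetaBipartite G (1 / (50 * (Δ : ℝ) ^ 2)) A B →
      (A.card : ℝ) ≤ (1 + 1 / (25 * (Δ : ℝ) ^ 2)) * (k : ℝ) →
      (B.card : ℝ) ≤ (1 + 1 / (25 * (Δ : ℝ) ^ 2)) * (k : ℝ) →
      ∀ (W : Type*) [Fintype W] [DecidableEq W] (T : SimpleGraph W) [DecidableRel T.Adj],
        IsTreeOfClass T k (Δ : ℝ) → T ⊑ G) := by
  refine ⟨?_, ?_⟩
  · intro hk hn W _ _ T _ hT
    exact isContained_of_card_le G k (by convert hd) (by convert hδ) (by omega) hn T hT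
  · intro Δ hΔ hk A B hAB hA hB W _ _ T _ hT
    exact isContained_of_isBetaBipartite G k hd Δ hΔ hk A B hAB hA hB T hT
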